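/- Call a finite sequence $\mathbf{k}=(k_1,\ldots,k_n)$ of positive integers admissible if it is empty or $k_1\geq 2$. For admissible $\mathbf{k}$ put $$\zeta(\mathbf{k})=\sum_{m_1>\cdots>m_n>0}\frac{1}{m_1^{k_1}\cdots m_n^{k_n}},\qquad \zeta^{\star}(\mathbf{k})=\sum_{m_1\geq\cdots\geq m_n>0}\frac{1}{m_1^{k_1}\cdots m_n^{k_n}},$$ both equal to $1$ for the empty sequence, and let the interpolated multiple zeta value be the polynomial $$\zeta^t(\mathbf{k})=\sum_{\mathbf{p}=(k_1\,\Box\,k_2\,\Box\cdots\Box\,k_n)} t^{\,n-\mathrm{dep}(\mathbf{p})}\,\zeta(\mathbf{p})\in\mathbb{R}[t],$$ where each box $\Box$ is independently a comma or a plus sign and $\mathrm{dep}(\mathbf{p})$ is the number of entries of $\mathbf{p}$. Write $\{a\}^n$ for the sequence of $n$ entries $a$. Let the Bernoulli numbers be given by $\frac{u}{e^u-1}=\sum_{m\geq 0}\frac{B_m}{m!}u^m$, and put $\beta_{2m}=(2-4^m)B_{2m}$, $\lambda=2\pi\sqrt{-1}$ and $\rho_k=e^{\pi\sqrt{-1}/k}$.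 Theorem. For all integers $k\geq 1$ and $n\geq 0$, the following two identities of polynomials in the variable $t$ hold: $$\zeta^t(\{2k\}^n)=\sum_{\substack{i+j=n\\ i,j\geq 0}}\zeta(\{2k\}^i)\,\zeta^{\star}(\{2k\}^j)\,(1-t)^i t^j$$ and $$\zeta^t(\{2k\}^n)=\sum_{\substack{i+j=n\\ i,j\geq 0}}(t-1)^i t^j\sum_{\substack{n_0+\cdots+n_{k-1}=ik\\ m_0+\cdots+m_{k-1}=jk\\ n_l,\,m_l\geq 0}}\rho_k^{\,2\sum_{l=0}^{k-1}l(n_l+m_l)}\left(\prod_{l=0}^{k-1}\frac{\beta_{2m_l}}{(2n_l+1)!\,(2m_l)!}\right)\frac{\lambda^{2nk}}{4^{nk}}.$$ -/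

import Mathlib

/-- An index (finite sequence of positive integers) that is empty or starts with an entry `≥ 2`. -/
def IsAdmissibleIndex (ks : List ℕ) : Prop :=
  (∀ k ∈ ks, 1 ≤ k) ∧ ∀ k ∈ ks.head?, 2 ≤ k

/-- The multiple zeta value
`ζ(k₁, …, kₙ) = ∑_{m₁ > m₂ > ⋯ > mₙ > 0} 1 / (m₁ ^ k₁ ⋯ mₙ ^ kₙ)`; it is `1` for the empty index.
The series converges for every admissible index, see `summable_mzv`. -/
noncomputable def mzv (ks : List ℕ) : ℝ :=
  ∑' m : {m : Fin ks.length → ℕ // StrictAnti m ∧ ∀ i, 0 < m i},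
    ∏ i, 1 / (m.1 i : ℝ) ^ ks.get i

/-- The multiple zeta-star value
`ζ⋆(k₁, …, kₙ) = ∑_{m₁ ≥ m₂ ≥ ⋯ ≥ mₙ > 0} 1 / (m₁ ^ k₁ ⋯ mₙ ^ kₙ)`; it is `1` for the empty index.
The series converges for every admissible index, see `summable_mzsv`. -/
noncomputable def mzsv (ks : List ℕ) : ℝ :=
  ∑' m : {m : Fin ks.length → ℕ // Antitone m ∧ ∀ i, 0 < m i},
    ∏ i, 1 / (m.1 i : ℝ) ^ ks.get i

/-- The list of all indices `(a □ k₁ □ ⋯ □ kₙ)`, each box being a comma or a plus sign. -/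
def boxIndicesFrom (a : ℕ) : List ℕ → List (List ℕ)
  | [] => [[a]]
  | b :: ks => (boxIndicesFrom b ks).map (a :: ·) ++ boxIndicesFrom (a + b) ks

/-- The list of all indices `(k₁ □ k₂ □ ⋯ □ kₙ)`, each box being a comma or a plus sign
(one entry for each of the choices of the boxes). -/
def boxIndices : List ℕ → List (List ℕ)
  | [] => [[]]
  | k :: ks => boxIndicesFrom k ks

/-- The interpolated multiple zeta value `ζᵗ(k₁, …, kₙ) = ∑_p t ^ (n - dep p) ζ(p)`, a polynomial
in the variable `t`; the sum is over all `p = (k₁ □ ⋯ □ kₙ)`, and always `dep p ≤ n`. -/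
noncomputable def tMZV (ks : List ℕ) : Polynomial ℝ :=
  ((boxIndices ks).map fun p =>
    Polynomial.X ^ (ks.length - p.length) * Polynomial.C (mzv p)).sum

/-- The rational number `β_{2m} = (2 - 4 ^ m) B_{2m}`, as a function of `m`. -/
def betaEven (m : ℕ) : ℚ := (2 - 4 ^ m) * bernoulli (2 * m)

theorem summable_fin_prod {f : ℕ → ℝ} (h0 : ∀ x, 0 ≤ f x) (hf : Summable f) (n : ℕ) :
    Summable fun m : Fin n → ℕ => ∏ i, f (m i) := by
  induction n with
  | zero => exact Summable.of_finite
  | succ n ih =>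
    have h := hf.mul_of_nonneg ih h0 (fun m => Finset.prod_nonneg fun i _ => h0 _)
    rw [← (Fin.consEquiv fun _ : Fin (n + 1) => ℕ).summable_iff]
    refine h.congr fun x => ?_
    simp [Fin.consEquiv, Fin.prod_univ_succ]

theorem summable_mzsv {ks : List ℕ} (h : IsAdmissibleIndex ks) :
    Summable fun m : {m : Fin ks.length → ℕ // Antitone m ∧ ∀ i, 0 < m i} =>
      ∏ i, 1 / (m.1 i : ℝ) ^ ks.get i := by
  obtain ⟨h1, h2⟩ := h
  cases ks with
  | nil =>
    have : Finite {m : Fin ([] : List ℕ).length → ℕ // Antitone m ∧ ∀ i, 0 < m i} := by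
      have : Finite (Fin ([] : List ℕ).length → ℕ) := by
        simp only [List.length_nil]; infer_instance
      infer_instance
    exact Summable.of_finite
  | cons k ks =>
    have hs : Summable fun x : ℕ => 1 / (x : ℝ) ^ (1 + 1 / ((ks.length + 1 : ℕ) : ℝ)) :=
      Real.summable_one_div_nat_rpow.2 (by
        have : (0 : ℝ) < 1 / ((ks.length + 1 : ℕ) : ℝ) := by positivity
        linarith)
    have hp := (summable_fin_prod (fun x => by positivity) hs (ks.length + 1)).comp_injective
      (Subtype.val_injective (p := fun m : Fin (ks.length + 1) → ℕ =>
        Antitone m ∧ ∀ i, 0 < m i))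
    refine Summable.of_nonneg_of_le (fun m => Finset.prod_nonneg fun i _ => by positivity)
      ?_ hp
    rintro ⟨m, hm, hpos⟩
    have hge : ∀ i, (1 : ℝ) ≤ m i := fun i => by exact_mod_cast hpos i
    have key : ∏ i, (m i : ℝ) ^ (1 + 1 / ((ks.length + 1 : ℕ) : ℝ)) ≤
        ∏ i, (m i : ℝ) ^ (k :: ks).get i := by
      have e1 : ∏ i, (m i : ℝ) ^ (1 + 1 / ((ks.length + 1 : ℕ) : ℝ)) =
          (∏ i, (m i : ℝ)) * ∏ i, (m i : ℝ) ^ (1 / ((ks.length + 1 : ℕ) : ℝ)) := by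
        rw [← Finset.prod_mul_distrib]
        refine Finset.prod_congr rfl fun i _ => ?_
        rw [Real.rpow_add (by linarith [hge i]), Real.rpow_one]
      have e2 : ∏ i, (m i : ℝ) ^ (1 / ((ks.length + 1 : ℕ) : ℝ)) ≤ m 0 := by
        calc _ ≤ ∏ _i : Fin (ks.length + 1), (m 0 : ℝ) ^ (1 / ((ks.length + 1 : ℕ) : ℝ)) := by
              refine Finset.prod_le_prod (fun i _ => by positivity) fun i _ => ?_
              refine Real.rpow_le_rpow (by positivity) ?_ (by positivity)
              exact_mod_cast hm (Fin.zero_le i)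
          _ = m 0 := by
              rw [Finset.prod_const, Finset.card_univ, Fintype.card_fin, ← Real.rpow_natCast,
                ← Real.rpow_mul (by positivity), one_div_mul_cancel (by positivity),
                Real.rpow_one]
      rw [e1]
      refine (mul_le_mul_of_nonneg_left e2 (Finset.prod_nonneg fun i _ => by positivity)).trans ?_
      have e3 : ∏ i : Fin ks.length, (m i.succ : ℝ) ≤
          ∏ i : Fin ks.length, (m i.succ : ℝ) ^ ks.get i := by
        refine Finset.prod_le_prod (fun i _ => by positivity) fun i _ => ?_
        exact le_self_pow₀ (hge i.succ) (by
          have := h1 (ks.get i) (List.mem_cons_of_mem _ (List.get_mem ks i)); omega)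
      have e4 : (m 0 : ℝ) * m 0 ≤ (m 0 : ℝ) ^ k := by
        rw [← sq]
        exact pow_le_pow_right₀ (hge 0) (h2 k (by simp))
      have f1 : ∏ i, (m i : ℝ) = m 0 * ∏ i : Fin ks.length, (m i.succ : ℝ) :=
        Fin.prod_univ_succ (n := ks.length) _
      have f2 : ∏ i, (m i : ℝ) ^ (k :: ks).get i =
          (m 0 : ℝ) ^ k * ∏ i : Fin ks.length, (m i.succ : ℝ) ^ ks.get i :=
        Fin.prod_univ_succ (n := ks.length) _
      rw [f1, f2]
      calc _ = ((m 0 : ℝ) * m 0) * ∏ i : Fin ks.length, (m i.succ : ℝ) := by ring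
        _ ≤ _ := mul_le_mul e4 e3 (Finset.prod_nonneg fun i _ => by positivity) (by positivity)
    have kpos : 0 < ∏ i, (m i : ℝ) ^ (1 + 1 / ((ks.length + 1 : ℕ) : ℝ)) :=
      Finset.prod_pos fun i _ => Real.rpow_pos_of_pos (by linarith [hge i]) _
    simp only [Function.comp, one_div, Finset.prod_inv_distrib] at kpos key ⊢
    exact inv_anti₀ kpos key

theorem summable_mzv {ks : List ℕ} (h : IsAdmissibleIndex ks) :
    Summable fun m : {m : Fin ks.length → ℕ // StrictAnti m ∧ ∀ i, 0 < m i} =>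
      ∏ i, 1 / (m.1 i : ℝ) ^ ks.get i :=
  (summable_mzsv h).comp_injective
    (i := fun m : {m : Fin ks.length → ℕ // StrictAnti m ∧ ∀ i, 0 < m i} =>
      (⟨m.1, m.2.1.antitone, m.2.2⟩ : {m : Fin ks.length → ℕ // Antitone m ∧ ∀ i, 0 < m i}))
    (fun a b hab => Subtype.ext (by simpa using hab))

/-! Cut every summation variable at `N`. The generating series over `n` of the sums for `{a}^n` are
then finite products over `1 ≤ m ≤ N`: of `1 + X/m^a` for strict sums, of `(1 - X/m^a)⁻¹` for star
sums, and of `(1 + (1-t)X/m^a)/(1 - tX/m^a)` for interpolated ones. So the interpolated series is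
the strict one at `(1-t)X` times the star one at `tX` (`tTruncSeries_eq`). Comparing coefficients
and letting `N → ∞` gives the first identity, with any `a ≥ 2` in place of `2k`.

For the second, let `Z_a(X) = ∑ (-1)^i ζ({a}^i) X^i`, the inverse of the star series. With `z =
ρ_k²`, the factorization `1 - x^k = ∏ (1 - z^l x)` gives `Z_{2k}(X^k) = ∏ Z_2(z^l X)`
(`expand_mzvSeries`). Euler's sine product gives `Z_2(X) = sin(π√X)/(π√X)` (`mzvSeries_two`), and
the coefficients of its inverse are the `β_{2m}/(2m)!` up to powers of `-π²`
(`sinhcSeries_mul_betaSeries`). Reading off the coefficients of `X^{ik}` and `X^{jk}` evaluates both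
factors of the first identity. -/

/-! ### Truncated sums and their limits -/

/-- The finite set of sequences `(m₁, …, mₙ)` of positive integers at most `N` with `mⱼ < mᵢ + s`
for `i < j`: strictly decreasing for `s = 0` and weakly decreasing for `s = 1`. -/
def chains (s : ℕ) : (n : ℕ) → ℕ → Finset (Fin n → ℕ)
  | 0, _ => Finset.univ
  | n + 1, N => (Finset.range N).biUnion fun m => (chains s n (m + s)).image (Fin.cons (m + 1))

theorem mem_chains {s n N : ℕ} (hs : s ≤ 1) {m : Fin n → ℕ} :
    m ∈ chains s n N ↔ (∀ i, 0 < m i ∧ m i ≤ N) ∧ ∀ i j, i < j → m j < m i + s := by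
  induction n generalizing N with
  | zero => simpa [chains] using Subsingleton.elim _ _
  | succ n ih =>
    simp only [chains, Finset.mem_biUnion, Finset.mem_range, Finset.mem_image, ih]
    constructor
    · rintro ⟨a, ha, b, ⟨hb, hb'⟩, rfl⟩
      refine ⟨fun i => ?_, fun i j => ?_⟩
      · refine Fin.cases ?_ (fun i => ?_) i
        · simp; omega
        · have := hb i
          simp only [Fin.cons_succ]; omega
      · refine Fin.cases ?_ (fun i => ?_) i <;> refine Fin.cases ?_ (fun j => ?_) j
        · simp
        · intro _
          have := hb j
          simp only [Fin.cons_succ, Fin.cons_zero]; omega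
        · simp
        · intro h
          simpa using hb' i j (by simpa using h)
    · rintro ⟨h1, h2⟩
      refine ⟨m 0 - 1, by have := h1 0; omega, Fin.tail m, ⟨fun i => ?_, fun i j h => ?_⟩, ?_⟩
      · have := h1 0; have := h1 i.succ; have := h2 0 i.succ (Fin.succ_pos i)
        simp only [Fin.tail]; omega
      · exact h2 _ _ (by simpa using h)
      · rw [Nat.sub_add_cancel (h1 0).1, Fin.cons_self_tail]

/-- The truncation at `N` of the multiple zeta value (`s = 0`) or zeta-star value (`s = 1`). -/
noncomputable def truncSum (s : ℕ) : List ℕ → ℕ → ℝ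
  | [], _ => 1
  | k :: ks, N => ∑ m ∈ Finset.range N, 1 / ((m + 1 : ℕ) : ℝ) ^ k * truncSum s ks (m + s)

theorem truncSum_cons_succ (s k : ℕ) (ks : List ℕ) (N : ℕ) :
    truncSum s (k :: ks) (N + 1) = truncSum s (k :: ks) N +
      1 / ((N + 1 : ℕ) : ℝ) ^ k * truncSum s ks (N + s) := by
  simp only [truncSum, Finset.sum_range_succ]

theorem sum_chains (s : ℕ) (ks : List ℕ) (N : ℕ) :
    ∑ m ∈ chains s ks.length N, ∏ i, 1 / (m i : ℝ) ^ ks.get i = truncSum s ks N := by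
  induction ks generalizing N with
  | nil => simp [chains, truncSum]
  | cons k ks ih =>
    simp only [List.length_cons, chains, truncSum]
    rw [Finset.sum_biUnion]
    · refine Finset.sum_congr rfl fun m _ => ?_
      rw [Finset.sum_image (fun a _ b _ h => Fin.cons_right_injective _ h), ← ih, Finset.mul_sum]
      refine Finset.sum_congr rfl fun b _ => ?_
      exact (Fin.prod_univ_succ (n := ks.length) _).trans (by simp)
    · intro a _ b _ hab
      refine Finset.disjoint_left.2 fun x hx hy => hab ?_
      obtain ⟨_, _, rfl⟩ := Finset.mem_image.1 hx
      obtain ⟨_, _, h⟩ := Finset.mem_image.1 hy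
      simpa using (congrFun h 0).symm

theorem tendsto_sum_chains {s n : ℕ} (hs : s ≤ 1) {p : (Fin n → ℕ) → Prop}
    (hp : ∀ m, p m ↔ (∀ i, 0 < m i) ∧ ∀ i j, i < j → m j < m i + s) {f : (Fin n → ℕ) → ℝ}
    (hf : Summable fun m : {m // p m} => f m) :
    Filter.Tendsto (fun N => ∑ m ∈ chains s n N, f m) Filter.atTop
      (nhds (∑' m : {m // p m}, f m)) := by
  classical
  have hmono : Monotone fun N => (chains s n N).subtype p := by
    intro a b hab m
    simp only [Finset.mem_subtype, mem_chains hs]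
    exact fun h => ⟨fun i => ⟨(h.1 i).1, (h.1 i).2.trans hab⟩, h.2⟩
  have hlim := Filter.tendsto_atTop_finset_of_monotone hmono (fun m => by
    -- Any bound on the entries of `m` serves as cutoff; their sum is one.
    refine ⟨∑ i, m.1 i, ?_⟩
    have := (hp m.1).1 m.2
    simp only [Finset.mem_subtype, mem_chains hs]
    exact ⟨fun i => ⟨this.1 i, Finset.single_le_sum (fun _ _ => Nat.zero_le _)
      (Finset.mem_univ i)⟩, this.2⟩)
  refine (hf.hasSum.comp hlim).congr fun N => ?_
  exact Finset.sum_subtype_of_mem f fun m hm => (hp m).2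
    ⟨fun i => (((mem_chains hs).1 hm).1 i).1, ((mem_chains hs).1 hm).2⟩

theorem tendsto_truncSum_mzv {ks : List ℕ} (h : IsAdmissibleIndex ks) :
    Filter.Tendsto (truncSum 0 ks) Filter.atTop (nhds (mzv ks)) := by
  refine (tendsto_sum_chains zero_le_one (f := fun m => ∏ i, 1 / (m i : ℝ) ^ ks.get i) (fun m => ?_) (summable_mzv h)).congr (sum_chains 0 ks)
  exact ⟨fun h => ⟨h.2, fun i j hij => h.1 hij⟩, fun h => ⟨fun i j hij => h.2 i j hij, h.1⟩⟩

theorem tendsto_truncSum_mzsv {ks : List ℕ} (h : IsAdmissibleIndex ks) :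
    Filter.Tendsto (truncSum 1 ks) Filter.atTop (nhds (mzsv ks)) := by
  refine (tendsto_sum_chains le_rfl (f := fun m => ∏ i, 1 / (m i : ℝ) ^ ks.get i) (fun m => ?_) (summable_mzsv h)).congr (sum_chains 1 ks)
  refine ⟨fun h => ⟨h.2, fun i j hij => Nat.lt_succ_of_le (h.1 hij.le)⟩,
    fun h => ⟨fun i j hij => ?_, h.1⟩⟩
  rcases hij.eq_or_lt with rfl | hij
  · exact le_rfl
  · exact Nat.le_of_lt_succ (h.2 i j hij)

/-! ### Generating series of truncated strict and star sums -/

/-- The generating series of the truncated sums of the indices `(a, …, a)`. -/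
noncomputable def truncSeries (s a N : ℕ) : PowerSeries ℝ :=
  PowerSeries.mk fun n => truncSum s (List.replicate n a) N

@[simp] theorem truncSeries_zero (s a : ℕ) : truncSeries s a 0 = 1 := by
  ext n
  cases n <;> simp [truncSeries, truncSum, List.replicate_succ, PowerSeries.coeff_one]

theorem truncSeries_strict_succ (a N : ℕ) :
    truncSeries 0 a (N + 1) =
      (1 + PowerSeries.C (1 / ((N + 1 : ℕ) : ℝ) ^ a) * PowerSeries.X) * truncSeries 0 a N := by
  ext n
  rw [add_mul, mul_assoc, mul_comm PowerSeries.X]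
  cases n with
  | zero => simp [truncSeries, truncSum]
  | succ n =>
    simp only [map_add, one_mul, PowerSeries.coeff_C_mul, PowerSeries.coeff_succ_mul_X]
    simp only [truncSeries, PowerSeries.coeff_mk, List.replicate_succ, truncSum_cons_succ, add_zero]

/-- In a weakly decreasing chain the value `N + 1` may repeat, so removing one occurrence leaves the
cutoff at `N + 1`. The new factor therefore appears as an inverse. -/
theorem truncSeries_star_succ (a N : ℕ) :
    (1 - PowerSeries.C (1 / ((N + 1 : ℕ) : ℝ) ^ a) * PowerSeries.X) * truncSeries 1 a (N + 1) =
      truncSeries 1 a N := by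
  ext n
  rw [sub_mul, mul_assoc, mul_comm PowerSeries.X]
  cases n with
  | zero => simp [truncSeries, truncSum]
  | succ n =>
    simp only [map_sub, one_mul, PowerSeries.coeff_C_mul, PowerSeries.coeff_succ_mul_X]
    simp only [truncSeries, PowerSeries.coeff_mk, List.replicate_succ, truncSum_cons_succ]
    ring

/-! ### Interpolated sums and the first identity -/

theorem length_le_of_mem_boxIndicesFrom {b : ℕ} {ks p : List ℕ} (hp : p ∈ boxIndicesFrom b ks) :
    p.length ≤ ks.length + 1 := by
  induction ks generalizing b p with
  | nil => simp_all [boxIndicesFrom]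
  | cons c ks ih =>
    simp only [boxIndicesFrom, List.mem_append, List.mem_map] at hp
    rcases hp with ⟨q, hq, rfl⟩ | hp
    · simpa using ih hq
    · exact (ih hp).trans (by simp)

theorem le_of_mem_boxIndicesFrom {r b : ℕ} {ks p : List ℕ} (hb : r ≤ b) (hks : ∀ k ∈ ks, r ≤ k)
    (hp : p ∈ boxIndicesFrom b ks) : ∀ k ∈ p, r ≤ k := by
  induction ks generalizing b p with
  | nil => simp_all [boxIndicesFrom]
  | cons c ks ih =>
    simp only [List.mem_cons, forall_eq_or_imp] at hks
    simp only [boxIndicesFrom, List.mem_append, List.mem_map] at hp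
    rcases hp with ⟨q, hq, rfl⟩ | hp
    · simpa [hb] using ih hks.1 hks.2 hq
    · exact ih (by omega) hks.2 hp

theorem IsAdmissibleIndex.of_two_le {p : List ℕ} (h : ∀ k ∈ p, 2 ≤ k) : IsAdmissibleIndex p :=
  ⟨fun k hk => one_le_two.trans (h k hk), fun k hk => h k (List.mem_of_mem_head? hk)⟩

theorem isAdmissibleIndex_replicate {a : ℕ} (ha : 2 ≤ a) (n : ℕ) :
    IsAdmissibleIndex (List.replicate n a) :=
  .of_two_le fun _ hk => ha.trans_eq (List.eq_of_mem_replicate hk).symm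

theorem isAdmissibleIndex_of_mem_boxIndices {ks p : List ℕ} (hks : ∀ k ∈ ks, 2 ≤ k)
    (hp : p ∈ boxIndices ks) : IsAdmissibleIndex p := by
  cases ks with
  | nil => simp_all [boxIndices, IsAdmissibleIndex]
  | cons k ks =>
    simp only [List.mem_cons, forall_eq_or_imp] at hks
    exact .of_two_le (le_of_mem_boxIndicesFrom hks.1 hks.2 hp)

/-- The truncation at `N` of the interpolated multiple zeta value at the real number `t`. -/
noncomputable def tTruncSum (t : ℝ) (ks : List ℕ) (N : ℕ) : ℝ :=
  ((boxIndices ks).map fun p => t ^ (ks.length - p.length) * truncSum 0 p N).sum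

theorem tendsto_tTruncSum (t : ℝ) {ks : List ℕ} (hks : ∀ k ∈ ks, 2 ≤ k) :
    Filter.Tendsto (tTruncSum t ks) Filter.atTop (nhds ((tMZV ks).eval t)) := by
  have h : (tMZV ks).eval t =
      ((boxIndices ks).map fun p => t ^ (ks.length - p.length) * mzv p).sum := by
    simp only [tMZV, Polynomial.eval_listSum, List.map_map, Function.comp_def, Polynomial.eval_mul,
      Polynomial.eval_pow, Polynomial.eval_X, Polynomial.eval_C]
  rw [h]
  exact tendsto_list_sum _ fun p hp => (tendsto_truncSum_mzv
    (isAdmissibleIndex_of_mem_boxIndices hks hp)).const_mul _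

@[simp] theorem tTruncSum_nil (t : ℝ) (N : ℕ) : tTruncSum t [] N = 1 := by
  simp [tTruncSum, boxIndices, truncSum]

theorem tTruncSum_singleton_succ (t : ℝ) (b N : ℕ) :
    tTruncSum t [b] (N + 1) - tTruncSum t [b] N = 1 / ((N + 1 : ℕ) : ℝ) ^ b := by
  simp [tTruncSum, boxIndices, boxIndicesFrom, truncSum, Finset.sum_range_succ]

theorem tTruncSum_cons_cons (t : ℝ) (b c : ℕ) (ks : List ℕ) (N : ℕ) :
    tTruncSum t (b :: c :: ks) N =
      ((boxIndices (c :: ks)).map fun p =>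
        t ^ ((c :: ks).length - p.length) * truncSum 0 (b :: p) N).sum +
      t * tTruncSum t ((b + c) :: ks) N := by
  simp only [tTruncSum, boxIndices, boxIndicesFrom, List.map_append, List.sum_append, List.map_map,
    Function.comp_def, List.length_cons, Nat.add_sub_add_right]
  congr 1
  rw [← List.sum_map_mul_left]
  refine congrArg List.sum (List.map_congr_left fun p hp => ?_)
  -- A plus in the first box costs one unit of depth, hence one factor `t`; the length bound keeps
  -- the natural subtraction in the exponent from truncating.
  have := length_le_of_mem_boxIndicesFrom hp
  rw [Nat.succ_sub this, pow_succ]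
  ring

theorem tTruncSum_cons_cons_succ (t : ℝ) (b c : ℕ) (ks : List ℕ) (N : ℕ) :
    tTruncSum t (b :: c :: ks) (N + 1) - tTruncSum t (b :: c :: ks) N =
      1 / ((N + 1 : ℕ) : ℝ) ^ b * tTruncSum t (c :: ks) N +
      t * (tTruncSum t ((b + c) :: ks) (N + 1) - tTruncSum t ((b + c) :: ks) N) := by
  simp only [tTruncSum_cons_cons, truncSum_cons_succ, mul_add, List.sum_map_add, add_zero,
    mul_left_comm _ (1 / ((N + 1 : ℕ) : ℝ) ^ b), List.sum_map_mul_left]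
  rw [← tTruncSum]
  ring

/-- The increment from `N` to `N + 1` collects the terms whose largest variable is `N + 1`. Adding
`c` to the first entry multiplies each of them by `1/(N+1)^c`. -/
theorem tTruncSum_add_cons_succ (t : ℝ) (b c : ℕ) (ks : List ℕ) (N : ℕ) :
    tTruncSum t ((b + c) :: ks) (N + 1) - tTruncSum t ((b + c) :: ks) N =
      1 / ((N + 1 : ℕ) : ℝ) ^ c * (tTruncSum t (b :: ks) (N + 1) - tTruncSum t (b :: ks) N) := by
  induction ks generalizing b with
  | nil => simp only [tTruncSum_singleton_succ, pow_add]; field_simp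
  | cons d ks ih =>
    rw [tTruncSum_cons_cons_succ, tTruncSum_cons_cons_succ, add_right_comm, ih, pow_add]
    field_simp

/-- The generating series of the truncated interpolated sums of the indices `(a, …, a)`. -/
noncomputable def tTruncSeries (t : ℝ) (a N : ℕ) : PowerSeries ℝ :=
  PowerSeries.mk fun n => tTruncSum t (List.replicate n a) N

/-- With equal entries, the increment rule turns the merged term into `t/(N+1)^a` times the
increment of the shorter index. The recursion closes up within the indices `{a}^n`. -/
theorem tTruncSeries_succ (t : ℝ) (a N : ℕ) :
    (1 - PowerSeries.C (t * (1 / ((N + 1 : ℕ) : ℝ) ^ a)) * PowerSeries.X) *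
        tTruncSeries t a (N + 1) =
      (1 + PowerSeries.C ((1 - t) * (1 / ((N + 1 : ℕ) : ℝ) ^ a)) * PowerSeries.X) *
        tTruncSeries t a N := by
  ext n
  rw [sub_mul, mul_assoc, mul_comm PowerSeries.X, add_mul, mul_assoc, mul_comm PowerSeries.X]
  cases n with
  | zero => simp [tTruncSeries]
  | succ n =>
    simp only [map_sub, map_add, one_mul, PowerSeries.coeff_C_mul, PowerSeries.coeff_succ_mul_X]
    simp only [tTruncSeries, PowerSeries.coeff_mk]
    cases n with
    | zero =>
      have := tTruncSum_singleton_succ t a N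
      simp only [List.replicate_succ, List.replicate_zero, tTruncSum_nil]
      linear_combination this
    | succ n =>
      have h := tTruncSum_cons_cons_succ t a a (List.replicate n a) N
      rw [tTruncSum_add_cons_succ] at h
      simp only [List.replicate_succ]
      linear_combination h

@[simp] theorem tTruncSeries_zero (t : ℝ) (a : ℕ) : tTruncSeries t a 0 = 1 := by
  have h0 : ∀ b ks, tTruncSum t (b :: ks) 0 = 0 := by
    intro b ks
    induction ks generalizing b with
    | nil => simp [tTruncSum, boxIndices, boxIndicesFrom, truncSum]
    | cons c ks ih => simp [tTruncSum_cons_cons, ih, truncSum]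
  ext n
  cases n <;> simp [tTruncSeries, List.replicate_succ, PowerSeries.coeff_one, h0]

theorem rescale_C_mul_X {R : Type*} [CommSemiring R] (r u : R) :
    PowerSeries.rescale r (PowerSeries.C u * PowerSeries.X) =
      PowerSeries.C (r * u) * PowerSeries.X := by
  ext n
  rw [PowerSeries.coeff_rescale, PowerSeries.coeff_C_mul, PowerSeries.coeff_C_mul,
    PowerSeries.coeff_X]
  split_ifs with h
  · simp [h]
  · simp

theorem tTruncSeries_eq (t : ℝ) (a N : ℕ) :
    tTruncSeries t a N = PowerSeries.rescale (1 - t) (truncSeries 0 a N) *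
      PowerSeries.rescale t (truncSeries 1 a N) := by
  induction N with
  | zero => simp
  | succ N ih =>
    set u : ℝ := 1 / ((N + 1 : ℕ) : ℝ) ^ a with hu
    -- The star factor enters through its inverse, so both sides are compared after multiplying by
    -- this series with constant term `1`.
    have hne : (1 - PowerSeries.C (t * u) * PowerSeries.X : PowerSeries ℝ) ≠ 0 := fun h => by
      simpa using congrArg PowerSeries.constantCoeff h
    apply mul_left_cancel₀ hne
    have h2 := congrArg (PowerSeries.rescale t) (truncSeries_star_succ a N)
    rw [map_mul, map_sub, map_one, ← hu, rescale_C_mul_X] at h2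
    rw [tTruncSeries_succ, ih, truncSeries_strict_succ, map_mul (PowerSeries.rescale (1 - t)),
      map_add (PowerSeries.rescale (1 - t)), map_one, ← hu, rescale_C_mul_X, ← h2]
    ring

theorem tMZV_replicate {a : ℕ} (ha : 2 ≤ a) (n : ℕ) :
    tMZV (List.replicate n a) =
      ∑ ij ∈ Finset.HasAntidiagonal.antidiagonal n,
        Polynomial.C (mzv (List.replicate ij.1 a) * mzsv (List.replicate ij.2 a)) *
          (1 - Polynomial.X) ^ ij.1 * Polynomial.X ^ ij.2 := by
  refine Polynomial.funext fun t => ?_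
  have h1 := tendsto_tTruncSum t (ks := List.replicate n a)
    fun k hk => ha.trans_eq (List.eq_of_mem_replicate hk).symm
  have h2 : Filter.Tendsto (fun N => ∑ ij ∈ Finset.HasAntidiagonal.antidiagonal n,
      ((1 - t) ^ ij.1 * truncSum 0 (List.replicate ij.1 a) N) *
        (t ^ ij.2 * truncSum 1 (List.replicate ij.2 a) N)) Filter.atTop
      (nhds (∑ ij ∈ Finset.HasAntidiagonal.antidiagonal n,
      ((1 - t) ^ ij.1 * mzv (List.replicate ij.1 a)) *
        (t ^ ij.2 * mzsv (List.replicate ij.2 a)))) :=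
    tendsto_finsetSum _ fun ij _ =>
      ((tendsto_truncSum_mzv (isAdmissibleIndex_replicate ha _)).const_mul _).mul
        ((tendsto_truncSum_mzsv (isAdmissibleIndex_replicate ha _)).const_mul _)
  have h3 : ∀ N, tTruncSum t (List.replicate n a) N =
      ∑ ij ∈ Finset.HasAntidiagonal.antidiagonal n,
      ((1 - t) ^ ij.1 * truncSum 0 (List.replicate ij.1 a) N) *
        (t ^ ij.2 * truncSum 1 (List.replicate ij.2 a) N) := by
    intro N
    have := congrArg (PowerSeries.coeff n) (tTruncSeries_eq t a N)
    simpa only [PowerSeries.coeff_mul, PowerSeries.coeff_rescale, tTruncSeries, truncSeries,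
      PowerSeries.coeff_mk] using this
  rw [tendsto_nhds_unique h1 (h2.congr fun N => (h3 N).symm), Polynomial.eval_finsetSum]
  refine Finset.sum_congr rfl fun ij _ => ?_
  simp
  ring

/-! ### Inversion and factorization over roots of unity -/

/-- The signed generating series `∑ᵢ (-1) ^ i ζ({a}^i) X ^ i`. -/
noncomputable def mzvSeries (a : ℕ) : PowerSeries ℂ :=
  PowerSeries.mk fun i => (-1) ^ i * (mzv (List.replicate i a) : ℂ)

/-- The generating series `∑ⱼ ζ⋆({a}^j) X ^ j`. -/
noncomputable def mzsvSeries (a : ℕ) : PowerSeries ℂ :=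
  PowerSeries.mk fun j => (mzsv (List.replicate j a) : ℂ)

/-- The truncated version of `mzvSeries`. -/
noncomputable def mzvTruncSeries (a N : ℕ) : PowerSeries ℂ :=
  PowerSeries.map Complex.ofRealHom (PowerSeries.rescale (-1) (truncSeries 0 a N))

/-- The truncated version of `mzsvSeries`. -/
noncomputable def mzsvTruncSeries (a N : ℕ) : PowerSeries ℂ :=
  PowerSeries.map Complex.ofRealHom (truncSeries 1 a N)

theorem mzvTruncSeries_mul_mzsvTruncSeries (a N : ℕ) :
    mzvTruncSeries a N * mzsvTruncSeries a N = 1 := by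
  rw [mzvTruncSeries, mzsvTruncSeries, ← map_mul]
  suffices h : PowerSeries.rescale (-1) (truncSeries 0 a N) * truncSeries 1 a N = 1 by
    rw [h, map_one]
  induction N with
  | zero => simp
  | succ N ih =>
    have h : PowerSeries.C (-1 * (1 / ((N + 1 : ℕ) : ℝ) ^ a)) =
        -PowerSeries.C (1 / ((N + 1 : ℕ) : ℝ) ^ a) := by rw [neg_one_mul, map_neg]
    rw [truncSeries_strict_succ, map_mul, map_add, map_one, rescale_C_mul_X, h]
    linear_combination ih +
      PowerSeries.rescale (-1) (truncSeries 0 a N) * truncSeries_star_succ a N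

theorem mzvTruncSeries_eq_prod (a N : ℕ) :
    mzvTruncSeries a N = ∏ m ∈ Finset.range N,
      (1 - PowerSeries.C (1 / ((m + 1 : ℕ) : ℂ) ^ a) * PowerSeries.X) := by
  induction N with
  | zero => simp [mzvTruncSeries]
  | succ N ih =>
    rw [Finset.prod_range_succ, ← ih, mzvTruncSeries, truncSeries_strict_succ, map_mul, map_mul,
      map_add, map_one, rescale_C_mul_X, mul_comm, mzvTruncSeries]
    simp [sub_eq_add_neg]

section PiTopology

open scoped PowerSeries.WithPiTopology

theorem tendsto_mzvTruncSeries {a : ℕ} (ha : 2 ≤ a) :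
    Filter.Tendsto (mzvTruncSeries a) Filter.atTop (nhds (mzvSeries a)) := by
  rw [PowerSeries.WithPiTopology.tendsto_iff_coeff_tendsto]
  intro i
  have h := ((Complex.continuous_ofReal.tendsto _).comp
    (tendsto_truncSum_mzv (isAdmissibleIndex_replicate ha i))).const_mul ((-1 : ℂ) ^ i)
  refine (h.congr fun N => ?_).trans_eq ?_
  · simp [mzvTruncSeries, truncSeries]
  · simp [mzvSeries]

theorem tendsto_mzsvTruncSeries {a : ℕ} (ha : 2 ≤ a) :
    Filter.Tendsto (mzsvTruncSeries a) Filter.atTop (nhds (mzsvSeries a)) := by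
  rw [PowerSeries.WithPiTopology.tendsto_iff_coeff_tendsto]
  intro i
  have h := (Complex.continuous_ofReal.tendsto _).comp
    (tendsto_truncSum_mzsv (isAdmissibleIndex_replicate ha i))
  refine (h.congr fun N => ?_).trans_eq ?_
  · simp [mzsvTruncSeries, truncSeries]
  · simp [mzsvSeries]

theorem mzvSeries_mul_mzsvSeries {a : ℕ} (ha : 2 ≤ a) : mzvSeries a * mzsvSeries a = 1 := by
  have h := (tendsto_mzvTruncSeries ha).mul (tendsto_mzsvTruncSeries ha)
  simp only [mzvTruncSeries_mul_mzsvTruncSeries] at h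
  exact tendsto_nhds_unique h tendsto_const_nhds

theorem one_sub_pow_eq_prod {R : Type*} [CommRing R] [IsDomain R] {n : ℕ} {z : R}
    (hz : IsPrimitiveRoot z n) (hn : 0 < n) (x : R) :
    1 - x ^ n = ∏ l : Fin n, (1 - z ^ (l : ℕ) * x) := by
  rw [Fin.prod_univ_eq_prod_range fun l => 1 - z ^ l * x]
  simpa [Polynomial.eval_prod] using
    congrArg (Polynomial.eval 1) (X_pow_sub_C_eq_prod hz (α := x) hn rfl)

/-- Each factor `1 - (X/m²)^k` splits into the linear factors `1 - z^l X/m²`; swapping the two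
finite products groups them by `l`. -/
theorem expand_mzvTruncSeries {k : ℕ} (hk : k ≠ 0) {z : ℂ} (hz : IsPrimitiveRoot z k) (N : ℕ) :
    PowerSeries.expand k hk (mzvTruncSeries (2 * k) N) =
      ∏ l : Fin k, PowerSeries.rescale (z ^ (l : ℕ)) (mzvTruncSeries 2 N) := by
  simp only [mzvTruncSeries_eq_prod, map_prod]
  rw [Finset.prod_comm]
  refine Finset.prod_congr rfl fun m _ => ?_
  have hz' : IsPrimitiveRoot (PowerSeries.C z) k := hz.map_of_injective PowerSeries.C_injective
  have h := one_sub_pow_eq_prod hz' (Nat.pos_of_ne_zero hk)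
    (PowerSeries.C (1 / ((m + 1 : ℕ) : ℂ) ^ 2) * PowerSeries.X)
  rw [mul_pow, ← map_pow, div_pow, one_pow, ← pow_mul] at h
  rw [map_sub, map_one, map_mul, PowerSeries.expand_C, PowerSeries.expand_X, h]
  refine Finset.prod_congr rfl fun l _ => ?_
  rw [map_sub, map_one, rescale_C_mul_X, map_mul, map_pow, mul_assoc]

theorem expand_mzvSeries {k : ℕ} (hk : k ≠ 0) {z : ℂ} (hz : IsPrimitiveRoot z k) :
    PowerSeries.expand k hk (mzvSeries (2 * k)) =
      ∏ l : Fin k, PowerSeries.rescale (z ^ (l : ℕ)) (mzvSeries 2) := by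
  have h1 : Filter.Tendsto (fun N => PowerSeries.expand k hk (mzvTruncSeries (2 * k) N))
      Filter.atTop (nhds (PowerSeries.expand k hk (mzvSeries (2 * k)))) := by
    rw [PowerSeries.WithPiTopology.tendsto_iff_coeff_tendsto]
    intro i
    simp only [PowerSeries.coeff_expand]
    split_ifs
    · exact (PowerSeries.WithPiTopology.tendsto_iff_coeff_tendsto ..).1
        (tendsto_mzvTruncSeries (by omega)) _
    · exact tendsto_const_nhds
  have h2 : Filter.Tendsto
      (fun N => ∏ l : Fin k, PowerSeries.rescale (z ^ (l : ℕ)) (mzvTruncSeries 2 N))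
      Filter.atTop (nhds (∏ l : Fin k, PowerSeries.rescale (z ^ (l : ℕ)) (mzvSeries 2))) := by
    refine tendsto_finsetProd _ fun l _ => ?_
    rw [PowerSeries.WithPiTopology.tendsto_iff_coeff_tendsto]
    intro i
    simp only [PowerSeries.coeff_rescale]
    exact ((PowerSeries.WithPiTopology.tendsto_iff_coeff_tendsto ..).1
      (tendsto_mzvTruncSeries le_rfl) i).const_mul _
  exact tendsto_nhds_unique (h1.congr (expand_mzvTruncSeries hk hz)) h2

end PiTopology

/-! ### The series of `sinh √X / √X` and its inverse -/

/-- The power series `∑ₙ X ^ n / (2n+1)!`, that is `sinh √X / √X`. -/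
noncomputable def sinhcSeries : PowerSeries ℂ :=
  PowerSeries.mk fun n => 1 / ((2 * n + 1).factorial : ℂ)

/-- The power series `∑ₙ β₂ₙ X ^ n / (2n)!`, that is `√X / sinh √X`. -/
noncomputable def betaSeries : PowerSeries ℂ :=
  PowerSeries.mk fun n => ((betaEven n : ℚ) : ℂ) / ((2 * n).factorial : ℂ)

/-- This is `u/sinh u = 2·u/(e^u - 1) - 2u/(e^{2u} - 1)` at the level of coefficients `(2 - 2^m) B_m
/ m!`. -/
theorem expand_betaSeries :
    PowerSeries.expand 2 two_ne_zero betaSeries =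
      2 * bernoulliPowerSeries ℂ - PowerSeries.rescale 2 (bernoulliPowerSeries ℂ) := by
  ext m
  have h2 : (2 : PowerSeries ℂ) = PowerSeries.C 2 := (map_ofNat PowerSeries.C 2).symm
  rw [h2, PowerSeries.coeff_expand, map_sub, PowerSeries.coeff_C_mul, PowerSeries.coeff_rescale]
  simp only [bernoulliPowerSeries, betaSeries, PowerSeries.coeff_mk]
  rcases Nat.even_or_odd' m with ⟨j, rfl | rfl⟩
  · rw [if_pos (dvd_mul_right 2 j), Nat.mul_div_cancel_left _ two_pos, betaEven, pow_mul]
    push_cast [eq_ratCast]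
    ring
  · rw [if_neg (by omega)]
    -- The degree-one coefficient vanishes because `2 - 2^1 = 0`, the other odd ones because the
    -- Bernoulli numbers do.
    rcases Nat.eq_zero_or_pos j with rfl | hj
    · norm_num
    · simp [bernoulli_eq_zero_of_odd (odd_two_mul_add_one j) (by omega)]

theorem expand_sinhcSeries :
    2 * PowerSeries.X * PowerSeries.expand 2 two_ne_zero sinhcSeries =
      PowerSeries.exp ℂ - PowerSeries.evalNegHom (PowerSeries.exp ℂ) := by
  have h2 : (2 : PowerSeries ℂ) = PowerSeries.C 2 := (map_ofNat PowerSeries.C 2).symm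
  ext m
  rw [h2, mul_assoc, mul_comm PowerSeries.X, PowerSeries.coeff_C_mul, map_sub,
    PowerSeries.evalNegHom, PowerSeries.coeff_rescale, PowerSeries.coeff_exp]
  cases m with
  | zero => simp
  | succ m =>
    rw [PowerSeries.coeff_succ_mul_X, PowerSeries.coeff_expand]
    simp only [sinhcSeries, PowerSeries.coeff_mk]
    rcases Nat.even_or_odd' m with ⟨j, rfl | rfl⟩
    · rw [if_pos (dvd_mul_right 2 j), Nat.mul_div_cancel_left _ two_pos, pow_succ, pow_mul]
      simp
      ring
    · rw [if_neg (by omega), pow_succ, pow_succ, pow_mul]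
      simp

theorem sinhcSeries_mul_betaSeries : sinhcSeries * betaSeries = 1 := by
  suffices h : PowerSeries.expand 2 two_ne_zero (sinhcSeries * betaSeries) = 1 by
    ext n
    rw [← PowerSeries.coeff_expand_mul 2 two_ne_zero, h, PowerSeries.coeff_one,
      PowerSeries.coeff_one]
    simp
  set e := PowerSeries.exp ℂ with he
  have h5 : (PowerSeries.C 2 : PowerSeries ℂ) = 2 := map_ofNat PowerSeries.C 2
  have hne : (2 * PowerSeries.X * e : PowerSeries ℂ) ≠ 0 := by
    rw [← h5]
    refine mul_ne_zero (mul_ne_zero ((map_ne_zero_iff _ PowerSeries.C_injective).2 two_ne_zero)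
      PowerSeries.X_ne_zero) fun h => ?_
    simpa [he] using congrArg PowerSeries.constantCoeff h
  have h1 := bernoulliPowerSeries_mul_exp_sub_one ℂ
  have h2 := congrArg (PowerSeries.rescale (2 : ℂ)) h1
  have h3 := PowerSeries.exp_pow_eq_rescale_exp (A := ℂ) 2
  have h4 := PowerSeries.exp_mul_exp_neg_eq_one (A := ℂ)
  rw [map_mul, map_sub, map_one, PowerSeries.rescale_X, h5] at h2
  rw [Nat.cast_ofNat] at h3
  rw [← h3] at h2
  rw [← he] at h1 h2 h4
  apply mul_left_cancel₀ hne
  have h6 := expand_sinhcSeries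
  rw [← he] at h6
  rw [map_mul, expand_betaSeries]
  -- After multiplication by `2Xe` the left side is `(e² - 1)(2B(X) - B(2X))`. The relations `(e -
  -- 1)B(X) = X` and `(e² - 1)B(2X) = 2X` reduce it to `2(e + 1)X - 2X = 2Xe`.
  linear_combination (e * (2 * bernoulliPowerSeries ℂ -
    PowerSeries.rescale 2 (bernoulliPowerSeries ℂ))) * h6 - (2 * bernoulliPowerSeries ℂ -
    PowerSeries.rescale 2 (bernoulliPowerSeries ℂ)) * h4 + 2 * (e + 1) * h1 - h2

theorem coeff_prod_univ {R ι : Type*} [CommSemiring R] [Fintype ι] [DecidableEq ι]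
    (f : ι → PowerSeries R) (d : ℕ) :
    PowerSeries.coeff d (∏ i, f i) =
      ∑ a ∈ Finset.piAntidiag Finset.univ d, ∏ i, PowerSeries.coeff (a i) (f i) := by
  rw [PowerSeries.coeff_prod]
  refine Finset.sum_bij (fun a _ => a) (fun a ha => ?_) (fun a _ b _ h => DFunLike.coe_injective h)
    (fun a ha => ⟨Finsupp.equivFunOnFinite.symm a, ?_, ?_⟩) fun a _ => rfl
  · simpa using ha
  · simpa using ha
  · simp

/-! ### Euler's sine product and the evaluation of `Z_2` -/

theorem truncSum_nonneg (s : ℕ) (ks : List ℕ) (N : ℕ) : 0 ≤ truncSum s ks N := by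
  induction ks generalizing N with
  | nil => exact zero_le_one
  | cons k ks ih => exact Finset.sum_nonneg fun m _ => mul_nonneg (by positivity) (ih _)

theorem hasSum_truncSum_mul_pow (a N : ℕ) (w : ℂ) :
    HasSum (fun n => (truncSum 0 (List.replicate n a) N : ℂ) * w ^ n)
      (∏ j ∈ Finset.range N, (1 + 1 / ((j + 1 : ℕ) : ℂ) ^ a * w)) := by
  induction N with
  | zero =>
    convert! hasSum_single (f := fun n => (truncSum 0 (List.replicate n a) 0 : ℂ) * w ^ n) 0 ?_
    · simp [truncSum]
    · intro n hn
      obtain ⟨n, rfl⟩ := Nat.exists_eq_succ_of_ne_zero hn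
      simp [List.replicate_succ, truncSum]
  | succ N ih =>
    -- The recursion in `N` relates degree `n + 1` to degree `n`, so the constant term is split off.
    rw [← hasSum_nat_add_iff' 1]
    have h1 := (hasSum_nat_add_iff' 1).2 ih
    have h2 := h1.add (ih.mul_left (1 / ((N + 1 : ℕ) : ℂ) ^ a * w))
    convert! h2 using 1
    · ext n
      simp only [List.replicate_succ, truncSum_cons_succ, add_zero]
      push_cast
      ring
    · simp [Finset.prod_range_succ, truncSum]
      ring

/-- At `w = 1` each coefficient is at most the whole product `∏ (1 + 1/j^a)`, which is bounded by
`exp (∑ 1/j^a)`. Uniformity in both `n` and `N` is what dominated convergence needs. -/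
theorem exists_truncSum_replicate_le {a : ℕ} (ha : 2 ≤ a) :
    ∃ M : ℝ, ∀ n N, truncSum 0 (List.replicate n a) N ≤ M := by
  have hs : Summable fun j : ℕ => 1 / ((j + 1 : ℕ) : ℝ) ^ a :=
    (summable_nat_add_iff 1).2 (Real.summable_one_div_nat_pow.2 (by omega))
  refine ⟨Real.exp (∑' j : ℕ, 1 / ((j + 1 : ℕ) : ℝ) ^ a), fun n N => ?_⟩
  have h := hasSum_truncSum_mul_pow a N 1
  have h' : HasSum (fun n => truncSum 0 (List.replicate n a) N)
      (∏ j ∈ Finset.range N, (1 + 1 / ((j + 1 : ℕ) : ℝ) ^ a)) := by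
    rw [← Complex.hasSum_ofReal]
    simpa using h
  refine (le_hasSum h' n fun _ _ => truncSum_nonneg _ _ _).trans ?_
  calc _ ≤ ∏ j ∈ Finset.range N, Real.exp (1 / ((j + 1 : ℕ) : ℝ) ^ a) :=
        Finset.prod_le_prod (fun j _ => by positivity) fun j _ => by
          rw [add_comm]; exact Real.add_one_le_exp _
    _ = Real.exp (∑ j ∈ Finset.range N, 1 / ((j + 1 : ℕ) : ℝ) ^ a) := (Real.exp_sum _ _).symm
    _ ≤ _ := Real.exp_le_exp.2 (hs.sum_le_tsum _ fun j _ => by positivity)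

/-- The limit `N → ∞` passes through the sum over `n` by dominated convergence, with majorant
`M‖w‖^n`. -/
theorem hasSum_mzv_mul_pow {a : ℕ} (ha : 2 ≤ a) {w : ℂ} (hw : ‖w‖ < 1) {f : ℂ}
    (hf : Filter.Tendsto (fun N => ∏ j ∈ Finset.range N, (1 + 1 / ((j + 1 : ℕ) : ℂ) ^ a * w))
      Filter.atTop (nhds f)) :
    HasSum (fun n => (mzv (List.replicate n a) : ℂ) * w ^ n) f := by
  obtain ⟨M, hM⟩ := exists_truncSum_replicate_le ha
  have hb : Summable fun n => M * ‖w‖ ^ n :=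
    (summable_geometric_of_lt_one (norm_nonneg _) hw).mul_left M
  have hlim : ∀ n, Filter.Tendsto (fun N => (truncSum 0 (List.replicate n a) N : ℂ) * w ^ n)
      Filter.atTop (nhds ((mzv (List.replicate n a) : ℂ) * w ^ n)) := fun n =>
    ((Complex.continuous_ofReal.tendsto _).comp
      (tendsto_truncSum_mzv (isAdmissibleIndex_replicate ha n))).mul_const _
  have hle : ∀ N n, ‖(truncSum 0 (List.replicate n a) N : ℂ) * w ^ n‖ ≤ M * ‖w‖ ^ n := by
    intro N n
    rw [norm_mul, norm_pow, Complex.norm_of_nonneg (truncSum_nonneg _ _ _)]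
    exact mul_le_mul_of_nonneg_right (hM n N) (by positivity)
  have h := tendsto_tsum_of_dominated_convergence hb hlim (.of_forall hle)
  simp only [(hasSum_truncSum_mul_pow a _ w).tsum_eq] at h
  rw [tendsto_nhds_unique hf h]
  refine (Summable.of_norm_bounded hb fun n => ?_).hasSum
  exact le_of_tendsto (hlim n).norm (.of_forall fun N => hle N n)

theorem hasSum_sin_div {x : ℂ} (hx : x ≠ 0) :
    HasSum (fun n : ℕ => (-(Real.pi : ℂ) ^ 2) ^ n * (1 / ((2 * n + 1).factorial : ℂ)) * (x ^ 2) ^ n)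
      (Complex.sin (Real.pi * x) / (Real.pi * x)) := by
  have hpi : (Real.pi : ℂ) ≠ 0 := Complex.ofReal_ne_zero.2 Real.pi_ne_zero
  convert! (Complex.hasSum_sin (Real.pi * x)).div_const (Real.pi * x) using 1
  ext n
  rw [neg_pow, ← pow_mul, ← pow_mul, mul_pow]
  field_simp
  ring

/-- Both coefficient sequences expand the same function about `0`, and a power series expansion is
unique. -/
theorem eq_of_hasSum_mul_pow {c d : ℕ → ℂ}
    (h : ∀ y : ℂ, ‖y‖ < 1 → ∃ f, HasSum (fun n => c n * y ^ n) f ∧ HasSum (fun n => d n * y ^ n) f) :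
    c = d := by
  have key : ∀ b : ℕ → ℂ, (∀ y : ℂ, ‖y‖ < 1 →
      HasSum (fun n => b n * y ^ n) (∑' n, c n * y ^ n)) →
      HasFPowerSeriesAt (fun y => ∑' n, c n * y ^ n) (FormalMultilinearSeries.ofScalars ℂ b) 0 := by
    intro b hb
    rw [hasFPowerSeriesAt_iff]
    filter_upwards [Metric.ball_mem_nhds (0 : ℂ) one_pos] with y hy
    simpa [FormalMultilinearSeries.coeff_ofScalars, mul_comm] using hb y (by simpa using hy)
  have hc := key c fun y hy => by
    obtain ⟨f, hf, -⟩ := h y hy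
    exact hf.summable.hasSum
  have hd := key d fun y hy => by
    obtain ⟨f, hf, hf'⟩ := h y hy
    rwa [hf.tsum_eq]
  exact FormalMultilinearSeries.ofScalars_series_injective ℂ ℂ (hc.eq_formalMultilinearSeries hd)

theorem mzvSeries_two : mzvSeries 2 = PowerSeries.rescale (-(Real.pi : ℂ) ^ 2) sinhcSeries := by
  have h : (fun n => (-1 : ℂ) ^ n * (mzv (List.replicate n 2) : ℂ)) =
      fun n => (-(Real.pi : ℂ) ^ 2) ^ n * (1 / ((2 * n + 1).factorial : ℂ)) := by
    refine eq_of_hasSum_mul_pow fun y hy => ?_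
    rcases eq_or_ne y 0 with rfl | hy0
    · refine ⟨1, ?_, ?_⟩
      · have h := hasSum_mzv_mul_pow (a := 2) le_rfl (w := 0) (f := 1) (by simp) (by simp)
        convert! h using 2 with n
        cases n <;> simp
      · convert! hasSum_single (f := fun n : ℕ => (-(Real.pi : ℂ) ^ 2) ^ n *
          (1 / ((2 * n + 1).factorial : ℂ)) * 0 ^ n) 0 ?_
        · simp
        · intro n hn
          simp [hn]
    -- A square root of `y` is chosen because the sine product is a function of `x`; taking `w =
    -- -x²` below turns `1 + w/j²` into its factors.
    · obtain ⟨x, rfl⟩ := IsAlgClosed.exists_pow_nat_eq y two_pos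
      have hx : x ≠ 0 := fun h => hy0 (by simp [h])
      refine ⟨_, ?_, hasSum_sin_div hx⟩
      have h := hasSum_mzv_mul_pow (a := 2) le_rfl (w := -x ^ 2) (by simpa using hy)
        ((tendsto_euler_sin_prod' hx).congr fun N => Finset.prod_congr rfl fun j _ => by
          simp [sineTerm]; ring)
      convert! h using 2 with n
      rw [neg_pow (x ^ 2)]
      ring
  ext n
  rw [PowerSeries.coeff_rescale]
  simpa [mzvSeries, sinhcSeries] using congrFun h n

/-! ### Explicit evaluations and the second identity -/

theorem mzv_replicate_eq_sum {k : ℕ} (hk : k ≠ 0) {z : ℂ} (hz : IsPrimitiveRoot z k) (i : ℕ) :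
    (-1) ^ i * (mzv (List.replicate i (2 * k)) : ℂ) =
      ∑ a ∈ Finset.piAntidiag (Finset.univ : Finset (Fin k)) (i * k),
        z ^ (∑ l : Fin k, (l : ℕ) * a l) * (-(Real.pi : ℂ) ^ 2) ^ (i * k) *
          ∏ l : Fin k, 1 / ((2 * a l + 1).factorial : ℂ) := by
  have h := congrArg (PowerSeries.coeff (k * i)) (expand_mzvSeries hk hz)
  rw [PowerSeries.coeff_expand_mul, coeff_prod_univ, mul_comm k, mzvSeries_two] at h
  rw [mzvSeries, PowerSeries.coeff_mk] at h
  rw [h]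
  refine Finset.sum_congr rfl fun a ha => ?_
  rw [← (Finset.mem_piAntidiag.1 ha).1, ← Finset.prod_pow_eq_pow_sum, ← Finset.prod_pow_eq_pow_sum,
    ← Finset.prod_mul_distrib, ← Finset.prod_mul_distrib]
  refine Finset.prod_congr rfl fun l _ => ?_
  rw [PowerSeries.coeff_rescale, PowerSeries.coeff_rescale, sinhcSeries, PowerSeries.coeff_mk,
    pow_mul, mul_assoc]

theorem expand_mzsvSeries {k : ℕ} (hk : k ≠ 0) {z : ℂ} (hz : IsPrimitiveRoot z k) :
    PowerSeries.expand k hk (mzsvSeries (2 * k)) = ∏ l : Fin k,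
      PowerSeries.rescale (z ^ (l : ℕ)) (PowerSeries.rescale (-(Real.pi : ℂ) ^ 2) betaSeries) := by
  have h1 := congrArg (PowerSeries.expand k hk) (mzvSeries_mul_mzsvSeries (a := 2 * k) (by omega))
  rw [map_mul, map_one, mul_comm] at h1
  -- Both series are inverse to the expanded `Z_{2k}`, the product because `sinhcSeries` and
  -- `betaSeries` cancel for each `l`.
  refine left_inv_eq_right_inv h1 ?_
  rw [expand_mzvSeries hk hz, mzvSeries_two, ← Finset.prod_mul_distrib]
  refine Finset.prod_eq_one fun l _ => ?_
  rw [← map_mul, ← map_mul, sinhcSeries_mul_betaSeries, map_one, map_one]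

theorem mzsv_replicate_eq_sum {k : ℕ} (hk : k ≠ 0) {z : ℂ} (hz : IsPrimitiveRoot z k) (j : ℕ) :
    (mzsv (List.replicate j (2 * k)) : ℂ) =
      ∑ b ∈ Finset.piAntidiag (Finset.univ : Finset (Fin k)) (j * k),
        z ^ (∑ l : Fin k, (l : ℕ) * b l) * (-(Real.pi : ℂ) ^ 2) ^ (j * k) *
          ∏ l : Fin k, ((betaEven (b l) : ℚ) : ℂ) / ((2 * b l).factorial : ℂ) := by
  have h := congrArg (PowerSeries.coeff (k * j)) (expand_mzsvSeries hk hz)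
  rw [PowerSeries.coeff_expand_mul, coeff_prod_univ, mul_comm k] at h
  rw [mzsvSeries, PowerSeries.coeff_mk] at h
  rw [h]
  refine Finset.sum_congr rfl fun b hb => ?_
  rw [← (Finset.mem_piAntidiag.1 hb).1, ← Finset.prod_pow_eq_pow_sum, ← Finset.prod_pow_eq_pow_sum,
    ← Finset.prod_mul_distrib, ← Finset.prod_mul_distrib]
  refine Finset.prod_congr rfl fun l _ => ?_
  rw [PowerSeries.coeff_rescale, PowerSeries.coeff_rescale, betaSeries, PowerSeries.coeff_mk,
    pow_mul, mul_assoc]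

theorem two_pi_I_pow_div (n k : ℕ) :
    (2 * (Real.pi : ℂ) * Complex.I) ^ (2 * n * k) / 4 ^ (n * k) =
      (-(Real.pi : ℂ) ^ 2) ^ (n * k) := by
  rw [mul_assoc 2 n k, pow_mul, ← div_pow]
  congr 1
  rw [mul_pow, mul_pow, Complex.I_sq]
  ring

theorem mainTheorem6 (k n : ℕ) (hk : 1 ≤ k) :
    tMZV (List.replicate n (2 * k)) =
        ∑ ij ∈ Finset.HasAntidiagonal.antidiagonal n,
          Polynomial.C (mzv (List.replicate ij.1 (2 * k)) * mzsv (List.replicate ij.2 (2 * k))) *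
            (1 - Polynomial.X) ^ ij.1 * Polynomial.X ^ ij.2 ∧
      (tMZV (List.replicate n (2 * k))).map Complex.ofRealHom =
        ∑ ij ∈ Finset.HasAntidiagonal.antidiagonal n,
          (Polynomial.X - 1) ^ ij.1 * Polynomial.X ^ ij.2 *
            Polynomial.C
              (∑ a ∈ Finset.piAntidiag (Finset.univ : Finset (Fin k)) (ij.1 * k),
                ∑ b ∈ Finset.piAntidiag (Finset.univ : Finset (Fin k)) (ij.2 * k),
                  Complex.exp ((Real.pi : ℂ) * Complex.I / (k : ℂ)) ^
                      (2 * ∑ l : Fin k, (l : ℕ) * (a l + b l)) *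
                    (∏ l : Fin k, ((betaEven (b l) : ℚ) : ℂ) /
                      (((2 * a l + 1).factorial : ℂ) * ((2 * b l).factorial : ℂ))) *
                    ((2 * (Real.pi : ℂ) * Complex.I) ^ (2 * n * k) / 4 ^ (n * k))) := by
  refine ⟨tMZV_replicate (by omega) n, ?_⟩
  have hk0 : k ≠ 0 := by omega
  -- `ρ_k` itself is a `2k`-th root of unity; its square `e^{2πi/k}` is the primitive `k`-th root
  -- needed.
  have hz : IsPrimitiveRoot (Complex.exp ((Real.pi : ℂ) * Complex.I / (k : ℂ)) ^ 2) k := by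
    rw [← Complex.exp_nat_mul]
    convert! Complex.isPrimitiveRoot_exp k hk0 using 2
    push_cast
    ring
  rw [tMZV_replicate (by omega) n, Polynomial.map_sum]
  refine Finset.sum_congr rfl fun ij hij => ?_
  obtain ⟨i, j⟩ := ij
  obtain rfl : i + j = n := by simpa using hij
  -- The sign from `(1 - t)^i = (-1)^i (t - 1)^i` is the one built into `Z_{2k}`.
  have hC : (Polynomial.C (Complex.ofRealHom (mzv (List.replicate i (2 * k)) *
      mzsv (List.replicate j (2 * k)))) : Polynomial ℂ) * (1 - Polynomial.X) ^ i *
      Polynomial.X ^ j = (Polynomial.X - 1) ^ i * Polynomial.X ^ j *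
      Polynomial.C (((-1) ^ i * (mzv (List.replicate i (2 * k)) : ℂ)) *
        (mzsv (List.replicate j (2 * k)) : ℂ)) := by
    rw [← neg_sub Polynomial.X (1 : Polynomial ℂ), neg_pow (Polynomial.X - 1 : Polynomial ℂ)]
    simp only [map_mul, map_pow, map_neg, map_one, Complex.ofRealHom_eq_coe]
    ring
  simp only [Polynomial.map_mul, Polynomial.map_C, Polynomial.map_pow, Polynomial.map_sub,
    Polynomial.map_one, Polynomial.map_X]
  rw [hC, mzv_replicate_eq_sum hk0 hz, mzsv_replicate_eq_sum hk0 hz, Finset.sum_mul_sum]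
  congr 2
  refine Finset.sum_congr rfl fun a _ => Finset.sum_congr rfl fun b _ => ?_
  have hp : ∏ l : Fin k, ((betaEven (b l) : ℚ) : ℂ) /
      (((2 * a l + 1).factorial : ℂ) * ((2 * b l).factorial : ℂ)) =
      (∏ l : Fin k, 1 / ((2 * a l + 1).factorial : ℂ)) *
        ∏ l : Fin k, ((betaEven (b l) : ℚ) : ℂ) / ((2 * b l).factorial : ℂ) := by
    rw [← Finset.prod_mul_distrib]
    refine Finset.prod_congr rfl fun l _ => ?_
    rw [div_mul_div_comm, one_mul]
  rw [hp, two_pi_I_pow_div, pow_mul]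
  simp only [mul_add, Finset.sum_add_distrib, pow_add, add_mul]
  ring
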